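/- **Notation.** Let $\mathbb{R}[\mathbf x]=\mathbb{R}[x_1,\dots,x_n]$. For a set $B$ of monomials, $B^+=B\cup x_1B\cup\dots\cup x_nB$, $B^{[k]}$ is the $k$-fold prolongation, $\partial B=B^+\setminus B$, $\langle B\rangle$ is the linear span, $B_t$ is the set of elements of $B$ of degree $\le t$; $B$ is connected to $1$ if $1\in B$ and every $m\in B$, $m\ne1$, is $x_i m'$ for some $i$ and some $m'\in B$. For $S\subseteq\mathbb{R}[\mathbf x]$, $S_d$ is the set of elements of $S$ of degree $\le d$, $(S)$ is the ideal generated by $S$, and $\langle S\,|\,d\rangle$ is the span of the products $\mathbf x^\alpha g$ with $g\in S$, $|\alpha|+\deg g\le d$. A *rewriting family* for a finite $B$ is a set $F$ of polynomials supported on $B^+$, each having exactly one monomial $\gamma(g)$ in $\partial B$, with coefficient $1$, distinct elements having distinct $\gamma$. It is *complete in degree $d$* if $\deg\gamma(g)=\deg g$ for all $g\in F$ and every $m\in\partial B$ of degree $\le d$ is some $\gamma(g)$. $F$ is a *border basis for $B$ in degree $\le d$* if $B$ is connected to $1$, $F$ is a rewriting family for $B$ complete in degree $d$, and $\mathbb{R}[\mathbf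 x]_d=\langle B\rangle_d\oplus\langle F\,|\,d\rangle$. $F$ is a *border basis for $B$* if $B$ is connected to $1$, $F$ is a rewriting family for $B$ complete in all degrees, and $\mathbb{R}[\mathbf x]=\langle B\rangle\oplus(F)$; it is a border basis *of the ideal $I$* if moreover $(F)=I$. $\pi_{F,B}$ is the linear map with $\pi_{F,B}(m)=m$ for $m\in B$, $\pi_{F,B}(m)=m-g$ for $m=\gamma(g)\in\partial B$, and $\pi_{F,B}(m)=\pi_{F,B}(x_{i_0}\pi_{F,B}(m'))$ for $m=x_{i_0}m'\in B^{[k]}\setminus B^{[k-1]}$, $k\ge2$, $m'\in B^{[k-1]}$, $i_0$ minimal. $C^+(F)$ is the set of polynomials $mg-m'g'$ with $g,g'\in F$, $m,m'\in\{0,1,x_1,\dots,x_n\}$ and either $m\gamma(g)=m'\gamma(g')$, or $m\gamma(g)\in B$ and $m'=0$ (only elements having exactly one monomial in $\partial B$, with coefficient 1, are used). For a subspace $E$ and $G\subseteq\langle E\cdot E\rangle$, $\mathcal L_{G,E,\succcurlyeq}$ is the set of linear forms $\Lambda$ on $\langle E\cdot E\rangle$ with $\Lambda(G)=0$, $\Lambda(1)=1$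 and $\Lambda(p^2)\ge0$ for $p\in E$; $H^E_\Lambda:E\to E^*$ is $p\mapsto(q\mapsto\Lambda(pq))$. Put $p^\mu_{G,E}=\inf\{\Lambda(p):\Lambda\in\mathcal L_{G,E,\succcurlyeq}\}$ and $p^{sos}_{G,E}=\sup\{\lambda: p-\lambda=\sum h_i^2+h,\ h_i\in E,\ h\in G\}$. For a finite monomial set $M\ni1$, *Optimal Linear Form* $(f,M,\pi_{F,B})$ is the minimization of $\Lambda(f)$ over $\mathcal L_{G,E,\succcurlyeq}$, where $E=\langle M\rangle$ and $G$ is the span of those polynomials $b-\pi_{F,B}(b)$, $b\in M\cdot M$, which lie in $\langle M\cdot M\rangle$; here $f$ is represented by some $p\in\langle M\cdot M\rangle$ with $f-p\in\langle F\,|\,d\rangle$, $d$ being the current degree ($2t$ in step 4, $2(t-1)$ in step 4(e)). Its output is the minimum $f^*_{F,M}=p^\mu_{G,E}$ and a form $\Lambda^*\in\mathcal L_{G,E,\succcurlyeq}$ with $\Lambda^*(p)=p^\mu_{G,E}$ which is *generic*: $H^E_{\Lambda^*}$ has maximal rank among all such forms. There is a *duality gap* if $p^{sos}_{G,E}\neq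 p^\mu_{G,E}$. **Minimizer Ideal algorithm.** Input: $f\in\mathbb{R}[\mathbf x]$ for which $I_{min}(f)=\{p: p(x)=0 \text{ for every } x\in\mathbb{R}^n \text{ at which } f \text{ attains its minimum over } \mathbb{R}^n\}$ satisfies $I_{min}(f)\ne(1)$ and is zero-dimensional ($0<|V_{\mathbb C}(I_{min}(f))|<\infty$). Start with $F=\{\partial f/\partial x_1,\dots,\partial f/\partial x_n\}$, $t=\lceil\deg(f)/2\rceil$, $B$ the set of monomials of degree $\le t$, $\tilde f=-\infty$. Repeat: 1. Compute the elements of $C^+(F)$ of degree $\le2t$ with respect to $B$. 2. Reduce them by $F$, modulo $\langle F\,|\,2t\rangle$, to polynomials not containing any $\gamma(g)$, $g\in F$; let $R$ be the set of nonzero results. 3. Add $R$ to $F$ and update $B$: the new $(F,B)$ is such that $B$ is connected to $1$, $F$ is a rewriting family for $B$ complete in degree $2t$, all its elements are in the ideal generated by the old $F$ and $R$, and all elements of degree $\le2t$ of the old $F$ and of $R$ are in $\langle F\,|\,2t\rangle$. 4. Let $[f^*_{F,B_t},\Lambda^*]$ be an output of Optimal Linear Form $(f,B_t,\pi_{F,B})$.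 (a) If there is a duality gap, go to 1 with $t:=t+1$. (b) If $\tilde f\ne f^*_{F,B_t}$, put $\tilde f:=f^*_{F,B_t}$ and go to 1 with $t:=t+1$. (c) Compute a border basis $F'$ for $B'$ in degree $\le2(t-1)$ of the family $S=F\cup\ker H^{B_{t-1}}_{\Lambda^*}$, that is, with $S_{2(t-1)}\subseteq(F')\subseteq(S)$. (d) If some $b'\in B'$ has $\deg b'\ge t-1$, go to 1 with $t:=t+1$. (e) Let $[f^*_{F',B'},\Lambda']$ be an output of Optimal Linear Form $(f,B',\pi_{F',B'})$. (f) If $f^*_{F',B'}=\tilde f$ and $\ker H^{B'_{t-1}}_{\Lambda'}=\{0\}$, stop with the output $F'$, $B'$, $\tilde f$; otherwise go to 1 with $t:=t+1$. (The algorithm also goes to 1 with $t:=t+1$ if, after (a) and (b), an object to be computed in 4, (c) or (e) does not exist. The choices left open in the steps are arbitrary.) **Lemma.** Let $f$ be such an input. If the Minimizer Ideal algorithm terminates on $f$, with output $F'$, $B'$, $\tilde f$, then $F'$ is a border basis of $I_{min}(f)$ for the monomial basis $B'$: $B'$ is connected to $1$, $F'$ is a rewriting family for $B'$ complete in all degrees,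 $\mathbb{R}[\mathbf x]=\langle B'\rangle\oplus(F')$, and $(F')=I_{min}(f)$. -/

import Mathlib

noncomputable section

namespace MinimizerIdeal

open MvPolynomial

/-- Real polynomials in `n` variables. -/
abbrev Poly (n : ℕ) := MvPolynomial (Fin n) ℝ

/-- Monomials in `n` variables, given by their exponents. -/
abbrev Mon (n : ℕ) := Fin n →₀ ℕ

variable {n : ℕ}

/-! ### Monomial sets -/

/-- `B⁺ = B ∪ x₁ B ∪ ⋯ ∪ xₙ B`. -/
def prolong (B : Set (Mon n)) : Set (Mon n) :=
  B ∪ {m | ∃ b ∈ B, ∃ i, m = Finsupp.single i 1 + b}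

/-- The border `∂B = B⁺ \ B`. -/
def border (B : Set (Mon n)) : Set (Mon n) := prolong B \ B

/-- `B^[k]`, the `k`-fold prolongation. -/
def prolongIter (B : Set (Mon n)) (k : ℕ) : Set (Mon n) := prolong^[k] B

/-- The `B`-index of a monomial: the least `k` with `m ∈ B^[k]`. -/
def bIndex (B : Set (Mon n)) (m : Mon n) : ℕ := sInf {k | m ∈ prolongIter B k}

/-- `B_t`, the monomials of `B` of degree at most `t`. -/
def truncMon (B : Set (Mon n)) (t : ℕ) : Set (Mon n) := {m ∈ B | m.degree ≤ t}

/-- `B` is connected to `1`. -/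
def ConnectedToOne (B : Set (Mon n)) : Prop :=
  0 ∈ B ∧ ∀ m ∈ B, m ≠ 0 → ∃ i, ∃ b ∈ B, m = Finsupp.single i 1 + b

/-- The linear span `⟨B⟩` of a set of monomials. -/
def monSpan (B : Set (Mon n)) : Submodule ℝ (Poly n) :=
  Submodule.span ℝ ((fun m => monomial m (1 : ℝ)) '' B)

theorem monSpan_mono {B C : Set (Mon n)} (h : B ⊆ C) : monSpan B ≤ monSpan C :=
  Submodule.span_mono (Set.image_mono h)

theorem truncMon_subset (B : Set (Mon n)) (t : ℕ) : truncMon B t ⊆ B := fun _ h => h.1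

theorem truncMon_pred_subset (B : Set (Mon n)) (t : ℕ) :
    truncMon B (t - 1) ⊆ truncMon B t := fun _ h => ⟨h.1, h.2.trans (Nat.sub_le t 1)⟩

/-- `S_d`, the elements of `S` of degree at most `d`. -/
def truncPoly (S : Set (Poly n)) (d : ℕ) : Set (Poly n) := {p ∈ S | p.totalDegree ≤ d}

/-- `⟨S | d⟩`, the span of the products `x^α f` with `f ∈ S` and `|α| + deg f ≤ d`. -/
def spanD (S : Set (Poly n)) (d : ℕ) : Submodule ℝ (Poly n) :=
  Submodule.span ℝ
    {p | ∃ f ∈ S, ∃ α : Mon n, α.degree + f.totalDegree ≤ d ∧ p = monomial α 1 * f}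

/-! ### Border bases -/

/-- `μ = γ(f)`: the only monomial of `f` in `∂B` is `μ`, and its coefficient is `1`. -/
def IsLeading (B : Set (Mon n)) (f : Poly n) (μ : Mon n) : Prop :=
  μ ∈ border B ∧ coeff μ f = 1 ∧ ∀ ν ∈ f.support, ν ∈ border B → ν = μ

/-- `F` is a rewriting family for the finite monomial set `B`. -/
structure IsRewritingFamily (F : Set (Poly n)) (B : Set (Mon n)) : Prop where
  finite : B.Finite
  support_subset : ∀ f ∈ F, ∀ m ∈ f.support, m ∈ prolong B
  leading : ∀ f ∈ F, ∃ μ, IsLeading B f μ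
  leading_injective : ∀ f ∈ F, ∀ g ∈ F, ∀ μ, IsLeading B f μ → IsLeading B g μ → f = g

/-- `F` is graded: `deg γ(f) = deg f` for all `f ∈ F`. -/
def IsGraded (F : Set (Poly n)) (B : Set (Mon n)) : Prop :=
  ∀ f ∈ F, ∀ μ, IsLeading B f μ → μ.degree = f.totalDegree

/-- The rewriting family `F` for `B` is complete in degree `d`. -/
structure IsCompleteInDegree (F : Set (Poly n)) (B : Set (Mon n)) (d : ℕ) : Prop where
  rewriting : IsRewritingFamily F B
  graded : IsGraded F B
  complete : ∀ m ∈ border B, m.degree ≤ d → ∃ f ∈ F, IsLeading B f m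

/-- `F` is a border basis for `B` in degree `≤ d`:
`ℝ[x]_d = ⟨B⟩_d ⊕ ⟨F | d⟩`. -/
structure IsBorderBasisInDegree (F : Set (Poly n)) (B : Set (Mon n)) (d : ℕ) : Prop where
  connected : ConnectedToOne B
  complete : IsCompleteInDegree F B d
  disjoint : Disjoint (monSpan (truncMon B d)) (spanD F d)
  sup_eq : monSpan (truncMon B d) ⊔ spanD F d = restrictTotalDegree (Fin n) ℝ d

/-- `F` is a border basis for `B`: it is a rewriting family for `B`, complete in all degrees,
`B` is connected to `1`, and `ℝ[x] = ⟨B⟩ ⊕ (F)`. -/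
structure IsBorderBasis (F : Set (Poly n)) (B : Set (Mon n)) : Prop where
  connected : ConnectedToOne B
  complete : ∀ d, IsCompleteInDegree F B d
  isCompl : IsCompl (monSpan B) ((Ideal.span F).restrictScalars ℝ)

/-- `F` is a border basis of the ideal `I` for `B`. -/
def IsBorderBasisOf (I : Ideal (Poly n)) (F : Set (Poly n)) (B : Set (Mon n)) : Prop :=
  IsBorderBasis F B ∧ Ideal.span F = I

/-- `(F', B')` is a border basis in degree `≤ d` of the family `S`: it is a border basis in degree
`≤ d`, it consists of elements of the ideal `(S)`, and its ideal contains all elements of `S` of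
degree `≤ d`. -/
def IsBorderBasisOfFamily (S : Set (Poly n)) (d : ℕ) (F' : Set (Poly n)) (B' : Set (Mon n)) :
    Prop :=
  IsBorderBasisInDegree F' B' d ∧ F' ⊆ Ideal.span S ∧ truncPoly S d ⊆ Ideal.span F'

open Classical in
/-- The elementary rewriting of monomials of `B⁺`, extended linearly: `m ↦ m` if `m ∈ B`, and
`m ↦ m - f` if `m ∈ ∂B` is the leading monomial of `f ∈ F`
(monomials without rewriting rule are left as they are). -/
def rewriteStep (F : Set (Poly n)) (B : Set (Mon n)) : Poly n →ₗ[ℝ] Poly n :=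
  (basisMonomials (Fin n) ℝ).constr ℝ fun m =>
    if h : ∃ f ∈ F, IsLeading B f m then monomial m 1 - h.choose else monomial m 1

open Classical in
/-- The projection `π_{F,B}` on a monomial of `B`-index `k`: for `k = 0` it is the monomial itself;
for index `k + 1` write `m = x_{i₀} m'` with `m' ∈ B^[k]` and `i₀` the least possible variable
index, and rewrite `x_{i₀} π_{F,B}(m') ∈ ⟨B⁺⟩`. -/
def projMon (F : Set (Poly n)) (B : Set (Mon n)) : ℕ → Mon n → Poly n
  | 0, m => monomial m 1
  | k + 1, m =>
    if h : {i : Fin n | ∃ m' ∈ prolongIter B k, m = Finsupp.single i 1 + m'}.Nonempty then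
      let i₀ := WellFounded.min wellFounded_lt _ h
      rewriteStep F B (X i₀ * projMon F B k (m - Finsupp.single i₀ 1))
    else monomial m 1

/-- The projection `π_{F,B}`, extended linearly. -/
def proj (F : Set (Poly n)) (B : Set (Mon n)) : Poly n →ₗ[ℝ] Poly n :=
  (basisMonomials (Fin n) ℝ).constr ℝ fun m => projMon F B (bIndex B m) m

/-- The commutation relations `C⁺(F)`: the polynomials `m f - m' f'` with `f, f' ∈ F` and
`m, m' ∈ {0, 1, x₁, …, xₙ}` such that `m γ(f) = m' γ(f')`, or `m γ(f) ∈ B` and `m' = 0`. -/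
def commRelations (F : Set (Poly n)) (B : Set (Mon n)) : Set (Poly n) :=
  {c | ∃ f ∈ F, ∃ f' ∈ F, ∃ μ μ' : Mon n, IsLeading B f μ ∧ IsLeading B f' μ' ∧
    ∃ m ∈ ({0, 1} ∪ Set.range X : Set (Poly n)), ∃ m' ∈ ({0, 1} ∪ Set.range X : Set (Poly n)),
      (m * monomial μ 1 = m' * monomial μ' 1 ∨
        (∃ b ∈ B, m * monomial μ 1 = monomial b 1) ∧ m' = 0) ∧
      c = m * f - m' * f'}

/-! ### Truncated Hankel operators and the two optimization problems

For a subspace `E`, the product `E * E` of submodules is the linear span `⟨E · E⟩`. -/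

/-- The truncated Hankel operator `H_Λ^E : E → E^*`, `p ↦ (q ↦ Λ(p q))`. -/
def hankel (E : Submodule ℝ (Poly n)) (Λ : Module.Dual ℝ ↥(E * E)) :
    ↥E →ₗ[ℝ] Module.Dual ℝ ↥E :=
  LinearMap.mk₂ ℝ (fun p q : ↥E => Λ ⟨(p : Poly n) * q, Submodule.mul_mem_mul p.2 q.2⟩)
    (fun p p' q => by rw [← map_add]; congr 1; ext1; simp [add_mul])
    (fun c p q => by rw [← map_smul]; congr 1; ext1; simp)
    (fun p q q' => by rw [← map_add]; congr 1; ext1; simp [mul_add])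
    (fun c p q => by rw [← map_smul]; congr 1; ext1; simp)

/-- The restriction of `Λ ∈ ⟨E · E⟩^*` to `⟨E₀ · E₀⟩` for `E₀ ⊆ E`. -/
def restrictForm {E₀ E : Submodule ℝ (Poly n)} (h : E₀ ≤ E) (Λ : Module.Dual ℝ ↥(E * E)) :
    Module.Dual ℝ ↥(E₀ * E₀) :=
  Λ ∘ₗ Submodule.inclusion (mul_le_mul' h h)

/-- `ker H_Λ^{E₀}` for `E₀ ⊆ E` and `Λ ∈ ⟨E · E⟩^*`, as a space of polynomials. -/
def hankelKer {E₀ E : Submodule ℝ (Poly n)} (h : E₀ ≤ E) (Λ : Module.Dual ℝ ↥(E * E)) :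
    Submodule ℝ (Poly n) :=
  (LinearMap.ker (hankel E₀ (restrictForm h Λ))).map E₀.subtype

/-- `𝓛_{G,E,≽}`: the linear forms `Λ` on `⟨E · E⟩` with `Λ ⊥ G`, `Λ(1) = 1`, and `Λ(p²) ≥ 0` for
all `p ∈ E`. -/
def feasible (G : Set (Poly n)) (E : Submodule ℝ (Poly n)) : Set (Module.Dual ℝ ↥(E * E)) :=
  {Λ | (∀ g : ↥(E * E), (g : Poly n) ∈ G → Λ g = 0) ∧
    (∃ h : (1 : Poly n) ∈ E * E, Λ ⟨1, h⟩ = 1) ∧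
    ∀ p : ↥E, 0 ≤ hankel E Λ p p}

/-- `𝓢_{G,E}`: the polynomials `∑ hᵢ² + h` with `hᵢ ∈ E` and `h ∈ G`. -/
def sosCone (G : Set (Poly n)) (E : Submodule ℝ (Poly n)) : Set (Poly n) :=
  {p | ∃ l : List (Poly n), (∀ q ∈ l, q ∈ E) ∧ ∃ h ∈ G, p = (l.map fun q => q ^ 2).sum + h}

/-- `p^μ_{G,E} = inf {Λ(p) | Λ ∈ 𝓛_{G,E,≽}}`, which is `+∞` if there is no such `Λ`. -/
def muValue (G : Set (Poly n)) (E : Submodule ℝ (Poly n)) (p : ↥(E * E)) : EReal :=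
  ⨅ Λ ∈ feasible G E, ((Λ p : ℝ) : EReal)

/-- `p^sos_{G,E} = sup {c | p - c ∈ 𝓢_{G,E}}`, which is `-∞` if there is no such `c`. -/
def sosValue (G : Set (Poly n)) (E : Submodule ℝ (Poly n)) (p : ↥(E * E)) : EReal :=
  ⨆ (c : ℝ) (_ : (p : Poly n) - C c ∈ sosCone G E), (c : EReal)

/-- The elements of `𝓛_{G,E,≽}` at which the minimum of `Λ(p)` is reached. -/
def minForms (G : Set (Poly n)) (E : Submodule ℝ (Poly n)) (p : ↥(E * E)) :
    Set (Module.Dual ℝ ↥(E * E)) :=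
  {Λ ∈ feasible G E | ((Λ p : ℝ) : EReal) = muValue G E p}

/-- `Λ` is a possible output of the Optimal Linear Form problem: it reaches the minimum of `Λ(p)`
and is generic for `p`, that is, `H_Λ^E` has maximal rank among the forms reaching the minimum. -/
def IsOptimalLinearForm (G : Set (Poly n)) (E : Submodule ℝ (Poly n)) (p : ↥(E * E))
    (Λ : Module.Dual ℝ ↥(E * E)) : Prop :=
  Λ ∈ minForms G E p ∧ ∀ Λ' ∈ minForms G E p, (hankel E Λ').rank ≤ (hankel E Λ).rank

/-- The linear constraints of the problem Optimal Linear Form `(f, M, π_{F,B})`: the span of the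
polynomials `b - π_{F,B}(b)`, with `b ∈ M · M`, which lie in `⟨M · M⟩`. -/
def relations (F : Set (Poly n)) (B M : Set (Mon n)) : Set (Poly n) :=
  Submodule.span ℝ
    ({g | ∃ b ∈ M, ∃ b' ∈ M, g = monomial (b + b') 1 - proj F B (monomial (b + b') 1)} ∩
      ↑(monSpan M * monSpan M))

/-! ### The ideals -/

/-- The points of `ℝⁿ` where `f` is minimum. -/
def minimizers (f : Poly n) : Set (Fin n → ℝ) := {x | ∀ y, eval x f ≤ eval y f}

/-- The minimizer ideal `I_min(f)`: the polynomials vanishing at all minimizers of `f`. -/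
def minimizerIdeal (f : Poly n) : Ideal (Poly n) := vanishingIdeal ℝ (minimizers f)

/-- `I` is zero-dimensional: `0 < |V_ℂ(I)| < ∞`. -/
def IsZeroDimensional (I : Ideal (Poly n)) : Prop :=
  {x : Fin n → ℂ | ∀ p ∈ I, aeval x p = 0}.Nonempty ∧
    {x : Fin n → ℂ | ∀ p ∈ I, aeval x p = 0}.Finite

/-! ### The algorithm -/

/-- The variables `F`, `B`, `t`, `f̃` of the algorithm at the beginning of an iteration. -/
structure State (n : ℕ) where
  F : Set (Poly n)
  B : Set (Mon n)
  t : ℕ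
  fTilde : EReal

/-- Initialization: the partial derivatives of `f`, `t = ⌈deg f / 2⌉`, the monomials of degree
at most `t`, and `f̃ = -∞`. -/
def initState (f : Poly n) : State n where
  F := Set.range fun i => pderiv i f
  B := {m | m.degree ≤ (f.totalDegree + 1) / 2}
  t := (f.totalDegree + 1) / 2
  fTilde := ⊥

/-- `r` is a reduction of `c` by the relations `F` in degree `≤ d`. -/
def IsReduction (F : Set (Poly n)) (B : Set (Mon n)) (d : ℕ) (c r : Poly n) : Prop :=
  c - r ∈ spanD F d ∧ ∀ f ∈ F, ∀ μ, IsLeading B f μ → μ ∉ r.support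

/-- Steps 1 and 2: `R` is a set of nonzero reductions by `F` of the commutation relations of `F`
with respect to `B` in degree `≤ d`, one at least for each relation that is not reduced to `0`. -/
def IsReducedRelations (F : Set (Poly n)) (B : Set (Mon n)) (d : ℕ) (R : Set (Poly n)) : Prop :=
  (∀ r ∈ R, r ≠ 0 ∧ ∃ c ∈ truncPoly (commRelations F B) d, IsReduction F B d c r) ∧
    ∀ c ∈ truncPoly (commRelations F B) d, ∃ r, IsReduction F B d c r ∧ (r = 0 ∨ r ∈ R)

/-- Steps 1 to 3: the nonzero reduced relations `R` are added to `F`, and `B` is updated. After the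
update, `B₁` is connected to `1` and `F₁` is a rewriting family for `B₁`, complete in degree
`≤ 2t`, which consists of elements of the ideal `(F ∪ R)` and from which all elements of `F ∪ R`
of degree `≤ 2t` are obtained in degree `≤ 2t`. -/
def IsUpdate (s : State n) (F₁ : Set (Poly n)) (B₁ : Set (Mon n)) : Prop :=
  ∃ R, IsReducedRelations s.F s.B (2 * s.t) R ∧
    ConnectedToOne B₁ ∧ IsCompleteInDegree F₁ B₁ (2 * s.t) ∧
    F₁ ⊆ Ideal.span (s.F ∪ R) ∧
    truncPoly (s.F ∪ R) (2 * s.t) ⊆ spanD F₁ (2 * s.t)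

/-- The subspace `⟨B_t⟩`. -/
abbrev spaceAt (B : Set (Mon n)) (t : ℕ) : Submodule ℝ (Poly n) := monSpan (truncMon B t)

/-- The polynomial `p ∈ ⟨E · E⟩` represents the objective `f` modulo the relations `F` in degree
`≤ d`; this is `p = f` if `f ∈ ⟨E · E⟩` is not reduced. -/
def Represents (F : Set (Poly n)) (d : ℕ) {E : Submodule ℝ (Poly n)} (f : Poly n)
    (p : ↥(E * E)) : Prop :=
  f - p ∈ spanD F d

/-- Steps 1 to 3 and the optimization problem of step 4 in the state `s`, with the duality gap test
passed: `f^sos = f^μ`, the relations are `F`, `B`, and `p` is the objective. -/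
structure NoGap (f : Poly n) (s : State n) (F : Set (Poly n)) (B : Set (Mon n))
    (p : ↥(spaceAt B s.t * spaceAt B s.t)) : Prop where
  update : IsUpdate s F B
  objective : Represents F (2 * s.t) f p
  noGap : sosValue (relations F B (truncMon B s.t)) (spaceAt B s.t) p =
    muValue (relations F B (truncMon B s.t)) (spaceAt B s.t) p

/-- The tests (a) and (b) are passed, `Λ` is the form computed at step 4, and step (c) has computed
the border basis `F'`, `B'` of `F + ker H_Λ^{B_{t-1}}` in degree `≤ 2 (t - 1)`. -/
structure BasisComputed (f : Poly n) (s : State n) (F : Set (Poly n)) (B : Set (Mon n))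
    (p : ↥(spaceAt B s.t * spaceAt B s.t))
    (Λ : Module.Dual ℝ ↥(spaceAt B s.t * spaceAt B s.t))
    (F' : Set (Poly n)) (B' : Set (Mon n)) : Prop where
  noGap : NoGap f s F B p
  value : s.fTilde = muValue (relations F B (truncMon B s.t)) (spaceAt B s.t) p
  optimal : IsOptimalLinearForm (relations F B (truncMon B s.t)) (spaceAt B s.t) p Λ
  basis : IsBorderBasisOfFamily
    (F ∪ ↑(hankelKer (monSpan_mono (truncMon_pred_subset B s.t)) Λ)) (2 * (s.t - 1)) F' B'

/-- Test (d) is passed as well, that is, no `b' ∈ B'` has `deg b' ≥ t - 1`, and `Λ'` is the form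
computed at step (e), with `p'` the objective. -/
structure SecondForm (f : Poly n) (s : State n) (F : Set (Poly n)) (B : Set (Mon n))
    (p : ↥(spaceAt B s.t * spaceAt B s.t))
    (Λ : Module.Dual ℝ ↥(spaceAt B s.t * spaceAt B s.t))
    (F' : Set (Poly n)) (B' : Set (Mon n))
    (p' : ↥(monSpan B' * monSpan B')) (Λ' : Module.Dual ℝ ↥(monSpan B' * monSpan B')) : Prop where
  basisComputed : BasisComputed f s F B p Λ F' B'
  degree_lt : ¬ ∃ b ∈ B', s.t - 1 ≤ b.degree
  objective : Represents F' (2 * (s.t - 1)) f p'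
  optimal : IsOptimalLinearForm (relations F' B' B') (monSpan B') p' Λ'

/-- The stopping test (f): `f^*_{F',B'} = f̃` and `ker H_{Λ'}^{B'_{t-1}} = {0}`. -/
def StopTest (s : State n) (F' : Set (Poly n)) (B' : Set (Mon n))
    (p' : ↥(monSpan B' * monSpan B')) (Λ' : Module.Dual ℝ ↥(monSpan B' * monSpan B')) : Prop :=
  muValue (relations F' B' B') (monSpan B') p' = s.fTilde ∧
    hankelKer (monSpan_mono (truncMon_subset B' (s.t - 1))) Λ' = ⊥

/-- One iteration of the loop that does not stop; each case goes back to step 1 with `t + 1`. -/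
inductive LoopStep (f : Poly n) : State n → State n → Prop
  /-- (a) there is a duality gap -/
  | gap {s : State n} {F : Set (Poly n)} {B : Set (Mon n)}
      {p : ↥(spaceAt B s.t * spaceAt B s.t)} :
      IsUpdate s F B → Represents F (2 * s.t) f p →
      sosValue (relations F B (truncMon B s.t)) (spaceAt B s.t) p ≠
        muValue (relations F B (truncMon B s.t)) (spaceAt B s.t) p →
      LoopStep f s ⟨F, B, s.t + 1, s.fTilde⟩
  /-- (b) the value has changed -/
  | newValue {s : State n} {F : Set (Poly n)} {B : Set (Mon n)}
      {p : ↥(spaceAt B s.t * spaceAt B s.t)} :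
      NoGap f s F B p →
      s.fTilde ≠ muValue (relations F B (truncMon B s.t)) (spaceAt B s.t) p →
      LoopStep f s
        ⟨F, B, s.t + 1, muValue (relations F B (truncMon B s.t)) (spaceAt B s.t) p⟩
  /-- (d) some element of `B'` has too large a degree -/
  | largeDegree {s : State n} {F F' : Set (Poly n)} {B B' : Set (Mon n)}
      {p : ↥(spaceAt B s.t * spaceAt B s.t)}
      {Λ : Module.Dual ℝ ↥(spaceAt B s.t * spaceAt B s.t)} :
      BasisComputed f s F B p Λ F' B' → (∃ b ∈ B', s.t - 1 ≤ b.degree) →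
      LoopStep f s ⟨F, B, s.t + 1, s.fTilde⟩
  /-- (f) the stopping test fails -/
  | testFails {s : State n} {F F' : Set (Poly n)} {B B' : Set (Mon n)}
      {p : ↥(spaceAt B s.t * spaceAt B s.t)}
      {Λ : Module.Dual ℝ ↥(spaceAt B s.t * spaceAt B s.t)}
      {p' : ↥(monSpan B' * monSpan B')} {Λ' : Module.Dual ℝ ↥(monSpan B' * monSpan B')} :
      SecondForm f s F B p Λ F' B' p' Λ' → ¬ StopTest s F' B' p' Λ' →
      LoopStep f s ⟨F, B, s.t + 1, s.fTilde⟩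

  /-- the minimum at step 4 is not reached, or the border basis at step (c) does not exist -/
  | noBasis {s : State n} {F : Set (Poly n)} {B : Set (Mon n)}
      {p : ↥(spaceAt B s.t * spaceAt B s.t)} :
      NoGap f s F B p →
      s.fTilde = muValue (relations F B (truncMon B s.t)) (spaceAt B s.t) p →
      (¬ ∃ Λ F' B', BasisComputed f s F B p Λ F' B') →
      LoopStep f s ⟨F, B, s.t + 1, s.fTilde⟩
  /-- the minimum at step (e) is not reached -/
  | noSecondForm {s : State n} {F F' : Set (Poly n)} {B B' : Set (Mon n)}
      {p : ↥(spaceAt B s.t * spaceAt B s.t)}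
      {Λ : Module.Dual ℝ ↥(spaceAt B s.t * spaceAt B s.t)} :
      BasisComputed f s F B p Λ F' B' → (¬ ∃ b ∈ B', s.t - 1 ≤ b.degree) →
      (¬ ∃ p' Λ', SecondForm f s F B p Λ F' B' p' Λ') →
      LoopStep f s ⟨F, B, s.t + 1, s.fTilde⟩

/-- The algorithm, run on the input `f`, may terminate with the output `F'`, `B'`, `f̃ = v`: after
finitely many iterations it reaches a state in which the stopping test succeeds. -/
def TerminatesWith (f : Poly n) (F' : Set (Poly n)) (B' : Set (Mon n)) (v : EReal) : Prop :=
  ∃ s : State n, Relation.ReflTransGen (LoopStep f) (initState f) s ∧ s.fTilde = v ∧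
    ∃ F B p Λ p' Λ', SecondForm f s F B p Λ F' B' p' Λ' ∧ StopTest s F' B' p' Λ'

end MinimizerIdeal

end

/-!
# The output of the Minimizer Ideal algorithm

When the stopping test succeeds, `(F', B')` is a border basis in degree `≤ 2(t - 1)` and the elements
of `B'` have degree at most `t - 2`. This leaves enough room for the commutation relations: rewriting
`xᵢ b` defines commuting operators on `⟨B'⟩` (`commute_mulOp`), which make `⟨B'⟩` an `ℝ[x]`-module
annihilated by `F'`, and so `⟨B'⟩ ∩ (F') = 0` in all degrees (`disjoint_monSpan_ideal`).

The optimal form `Λ'` has an injective Hankel operator on `⟨B'⟩`, and so `Λ' ∘ π_{F',B'}` is a positive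
definite form `L` on the finite-dimensional algebra `A = ℝ[x] / (F')` (`exists_posDef_form`). Such an
algebra is a power of `ℝ`: it is reduced, and a residue field `ℂ` would produce an element whose
square is minus a nonzero square. Hence `(F')` is the vanishing ideal of its real zeros
(`realRadical_of_optimal`), and there is at least one. The evaluations at these points are feasible
for the second relaxation, so that `f - f̃` is nonnegative at all of them, while `L(f - f̃) = 0`;
therefore `f = f̃` at all real zeros of `F'`.

On the other hand all polynomials of `F` are in the ideal of the partial derivatives of `f`, and
therefore vanish at the minimizers. The evaluation at a minimizer is thus feasible for the first
relaxation, and `f̃ ≤ min f`. As `f̃` is a value of `f`, equality holds: the real zeros of `F'` are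
minimizers, which gives `I_min(f) ⊆ (F')`, and the evaluations at minimizers are optimal forms. The
kernel of the generic optimal form `Λ` is contained in the kernels of all optimal forms
(`ker_hankel_le_of_isOptimalLinearForm`), in particular of those evaluations, so that
`ker H_Λ ⊆ I_min(f)` and `(F') ⊆ I_min(f)`.
-/

noncomputable section

namespace MinimizerIdeal

open MvPolynomial

variable {n : ℕ}

/-! ### Rewriting and the projection on `⟨B⟩` -/

theorem monomial_mem_monSpan {B : Set (Mon n)} {m : Mon n} (h : m ∈ B) :
    (monomial m 1 : Poly n) ∈ monSpan B :=
  Submodule.subset_span ⟨m, h, rfl⟩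

theorem mem_monSpan_of_support_subset {B : Set (Mon n)} {p : Poly n}
    (h : ∀ m ∈ p.support, m ∈ B) : p ∈ monSpan B := by
  rw [p.as_sum]
  refine Submodule.sum_mem _ fun m hm => ?_
  rw [← mul_one (coeff m p), ← smul_eq_mul, ← smul_monomial]
  exact Submodule.smul_mem _ _ (monomial_mem_monSpan (h m hm))

theorem one_mem_monSpan {B : Set (Mon n)} (h : 0 ∈ B) : (1 : Poly n) ∈ monSpan B :=
  monomial_mem_monSpan h

theorem finiteDimensional_monSpan {B : Set (Mon n)} (h : B.Finite) :
    FiniteDimensional ℝ (monSpan B) :=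
  FiniteDimensional.span_of_finite ℝ (h.image _)

theorem X_mul_mem_monSpan_prolong {B : Set (Mon n)} (i : Fin n) {p : Poly n}
    (hp : p ∈ monSpan B) : X i * p ∈ monSpan (prolong B) := by
  induction hp using Submodule.span_induction with
  | mem p hp =>
    obtain ⟨b, hb, rfl⟩ := hp
    rw [X, monomial_mul, one_mul]
    exact monomial_mem_monSpan (Or.inr ⟨b, hb, i, rfl⟩)
  | zero => simp
  | add p q _ _ hp hq => rw [mul_add]; exact add_mem hp hq
  | smul c p _ hp => rw [mul_smul_comm]; exact Submodule.smul_mem _ _ hp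

open Classical in
theorem rewriteStep_monomial (F : Set (Poly n)) (B : Set (Mon n)) (m : Mon n) :
    rewriteStep F B (monomial m 1) =
      if h : ∃ f ∈ F, IsLeading B f m then monomial m 1 - h.choose else monomial m 1 := by
  rw [rewriteStep, ← congrFun (coe_basisMonomials (Fin n) ℝ) m, Module.Basis.constr_basis,
    congrFun (coe_basisMonomials (Fin n) ℝ) m]

theorem proj_monomial (F : Set (Poly n)) (B : Set (Mon n)) (m : Mon n) :
    proj F B (monomial m 1) = projMon F B (bIndex B m) m := by
  rw [proj, ← congrFun (coe_basisMonomials (Fin n) ℝ) m, Module.Basis.constr_basis]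

/-- Two linear endomorphisms agree modulo a subspace as soon as they do so on monomials. -/
theorem sub_mem_of_monomial {N : Submodule ℝ (Poly n)} {φ : Poly n →ₗ[ℝ] Poly n}
    (h : ∀ m, monomial m 1 - φ (monomial m 1) ∈ N) (p : Poly n) : p - φ p ∈ N := by
  have : LinearMap.range (LinearMap.id - φ) ≤ N := by
    rw [LinearMap.range_eq_map, ← (basisMonomials (Fin n) ℝ).span_eq, Submodule.map_span_le]
    rintro _ ⟨m, rfl⟩
    simpa using h m
  exact this ⟨p, rfl⟩

theorem sub_rewriteStep_mem_span (F : Set (Poly n)) (B : Set (Mon n)) (p : Poly n) :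
    p - rewriteStep F B p ∈ Submodule.span ℝ F := by
  classical
  refine sub_mem_of_monomial (fun m => ?_) p
  rw [rewriteStep_monomial]
  split_ifs with h
  · rw [sub_sub_cancel]
    exact Submodule.subset_span h.choose_spec.1
  · simp

theorem sub_rewriteStep_mem_ideal (F : Set (Poly n)) (B : Set (Mon n)) (p : Poly n) :
    p - rewriteStep F B p ∈ Ideal.span F :=
  Submodule.span_le_restrictScalars ℝ (Poly n) F (sub_rewriteStep_mem_span F B p)

theorem monomial_sub_projMon_mem_ideal (F : Set (Poly n)) (B : Set (Mon n)) (k : ℕ) (m : Mon n) :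
    monomial m 1 - projMon F B k m ∈ Ideal.span F := by
  induction k generalizing m with
  | zero => simp [projMon]
  | succ k ih =>
    rw [projMon]
    split_ifs with h
    · obtain ⟨m', -, hm'⟩ := WellFounded.min_mem wellFounded_lt _ h
      set i₀ := WellFounded.min wellFounded_lt _ h
      have h1 : (monomial m 1 : Poly n) = X i₀ * monomial (m - Finsupp.single i₀ 1) 1 := by
        rw [X, monomial_mul, one_mul, hm', add_tsub_cancel_left]
      have h2 := sub_rewriteStep_mem_ideal F B
        (X i₀ * projMon F B k (m - Finsupp.single i₀ 1))
      have h3 := Ideal.mul_mem_left _ (X i₀) (ih (m - Finsupp.single i₀ 1))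
      rw [h1]
      convert add_mem h3 h2 using 1
      ring
    · simp

theorem sub_proj_mem_ideal (F : Set (Poly n)) (B : Set (Mon n)) (p : Poly n) :
    p - proj F B p ∈ Ideal.span F := by
  refine sub_mem_of_monomial (N := (Ideal.span F).restrictScalars ℝ) (fun m => ?_) p
  rw [proj_monomial]
  exact monomial_sub_projMon_mem_ideal F B _ m

theorem spanD_le_ideal (F : Set (Poly n)) (d : ℕ) {p : Poly n} (hp : p ∈ spanD F d) :
    p ∈ Ideal.span F := by
  have : spanD F d ≤ (Ideal.span F).restrictScalars ℝ := by
    refine Submodule.span_le.2 ?_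
    rintro _ ⟨f, hf, α, -, rfl⟩
    exact Ideal.mul_mem_left _ _ (Ideal.subset_span hf)
  exact this hp

/-- If every border monomial has a rewriting rule, then one step of rewriting maps `⟨B⁺⟩` to
`⟨B⟩`. -/
theorem rewriteStep_mem {F : Set (Poly n)} {B : Set (Mon n)} (hF : IsRewritingFamily F B)
    (hc : ∀ m ∈ border B, ∃ f ∈ F, IsLeading B f m) {p : Poly n}
    (hp : p ∈ monSpan (prolong B)) : rewriteStep F B p ∈ monSpan B := by
  classical
  have : (monSpan (prolong B)).map (rewriteStep F B) ≤ monSpan B := by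
    rw [monSpan, Submodule.map_span_le]
    rintro _ ⟨m, hm, rfl⟩
    simp only
    rw [rewriteStep_monomial]
    split_ifs with h
    · obtain ⟨hfF, hmB, hcoeff, huniq⟩ := h.choose_spec
      refine mem_monSpan_of_support_subset fun ν hν => ?_
      rw [mem_support_iff, coeff_sub, coeff_monomial] at hν
      split_ifs at hν with hmν
      · exact absurd (by rw [← hmν, hcoeff, sub_self]) hν
      · have hν' : ν ∈ h.choose.support := by
          rw [mem_support_iff]
          intro h0
          exact hν (by rw [h0, sub_zero])
        by_contra hνB
        exact hmν (huniq ν hν' ⟨hF.support_subset _ hfF ν hν', hνB⟩).symm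
    · by_cases hmB : m ∈ B
      · exact monomial_mem_monSpan hmB
      · exact absurd (hc m ⟨hm, hmB⟩) h
  exact this ⟨p, hp, rfl⟩

theorem rewriteStep_eq_self {F : Set (Poly n)} {B : Set (Mon n)} {p : Poly n}
    (hp : p ∈ monSpan B) : rewriteStep F B p = p := by
  classical
  refine LinearMap.eqOn_span (f := rewriteStep F B) (g := LinearMap.id) ?_ hp
  rintro _ ⟨m, hm, rfl⟩
  simp only
  rw [rewriteStep_monomial, dif_neg]
  · rfl
  · rintro ⟨f, -, ⟨-, h⟩, -⟩
    exact h hm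

theorem prolongIter_succ (B : Set (Mon n)) (k : ℕ) :
    prolongIter B (k + 1) = prolong (prolongIter B k) :=
  Function.iterate_succ_apply' _ _ _

theorem exists_mem_prolongIter {B : Set (Mon n)} (h0 : 0 ∈ B) (m : Mon n) :
    ∃ k, m ∈ prolongIter B k := by
  induction hd : m.degree generalizing m with
  | zero => exact ⟨0, by rwa [(Finsupp.degree_eq_zero_iff m).1 hd]⟩
  | succ d ih =>
    have hm : m ≠ 0 := by rintro rfl; simp at hd
    obtain ⟨i, hi⟩ := Finsupp.ne_iff.1 hm
    have hle : Finsupp.single i 1 ≤ m :=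
      Finsupp.single_le_iff.2 (Nat.one_le_iff_ne_zero.2 hi)
    obtain ⟨m', rfl⟩ := exists_add_of_le hle
    rw [map_add, Finsupp.degree_single] at hd
    obtain ⟨k, hk⟩ := ih m' (by omega)
    refine ⟨k + 1, ?_⟩
    rw [prolongIter_succ]
    exact Or.inr ⟨m', hk, i, rfl⟩

/-- On a monomial whose `B`-index is exactly `k`, the recursion that defines `π_{F,B}` never meets
a monomial without rewriting rule, and it ends in `⟨B⟩`. -/
theorem projMon_mem {F : Set (Poly n)} {B : Set (Mon n)} (hF : IsRewritingFamily F B)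
    (hc : ∀ m ∈ border B, ∃ f ∈ F, IsLeading B f m) (k : ℕ) {m : Mon n}
    (hm : m ∈ prolongIter B k) (hk : ∀ j < k, m ∉ prolongIter B j) :
    projMon F B k m ∈ monSpan B := by
  induction k generalizing m with
  | zero => exact monomial_mem_monSpan hm
  | succ k ih =>
    rw [projMon]
    rw [prolongIter_succ] at hm
    obtain hm | ⟨b, hb, i, hi⟩ := hm
    · exact absurd hm (hk k (Nat.lt_succ_self k))
    have h : {i : Fin n | ∃ m' ∈ prolongIter B k, m = Finsupp.single i 1 + m'}.Nonempty :=
      ⟨i, b, hb, hi⟩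
    rw [dif_pos h]
    obtain ⟨m', hm', hmm'⟩ := WellFounded.min_mem wellFounded_lt _ h
    set i₀ := WellFounded.min wellFounded_lt _ h
    have h1 : m - Finsupp.single i₀ 1 = m' := by rw [hmm', add_tsub_cancel_left]
    simp only [h1]
    refine rewriteStep_mem hF hc (X_mul_mem_monSpan_prolong i₀ (ih hm' fun j hj hmj => ?_))
    refine hk (j + 1) (Nat.succ_lt_succ hj) ?_
    rw [prolongIter_succ]
    exact Or.inr ⟨m', hmj, i₀, hmm'⟩

theorem proj_mem {F : Set (Poly n)} {B : Set (Mon n)} (hF : IsRewritingFamily F B)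
    (hc : ∀ m ∈ border B, ∃ f ∈ F, IsLeading B f m) (h0 : 0 ∈ B) (p : Poly n) :
    proj F B p ∈ monSpan B := by
  have : LinearMap.range (proj F B) ≤ monSpan B := by
    rw [LinearMap.range_eq_map, ← (basisMonomials (Fin n) ℝ).span_eq, Submodule.map_span_le]
    rintro _ ⟨m, rfl⟩
    rw [coe_basisMonomials, proj_monomial]
    exact projMon_mem hF hc _ (Nat.sInf_mem (exists_mem_prolongIter h0 m))
      fun j hj => Nat.notMem_of_lt_sInf hj
  exact this ⟨p, rfl⟩

/-! ### From a border basis in bounded degree to a border basis -/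

theorem monSpan_sup_ideal_eq_top {F : Set (Poly n)} {B : Set (Mon n)} (hF : IsRewritingFamily F B)
    (hc : ∀ m ∈ border B, ∃ f ∈ F, IsLeading B f m) (h0 : 0 ∈ B) :
    monSpan B ⊔ (Ideal.span F).restrictScalars ℝ = ⊤ := by
  refine eq_top_iff.2 fun p _ => ?_
  rw [← add_sub_cancel (proj F B p) p]
  exact Submodule.add_mem_sup (proj_mem hF hc h0 p) (sub_proj_mem_ideal F B p)

/-- The multiplication operator `⟨B⟩ → ⟨B⟩`, `b ↦ ρ(xᵢ b)`, where `ρ` is one step of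
rewriting. -/
def mulOp {F : Set (Poly n)} {B : Set (Mon n)} (hF : IsRewritingFamily F B)
    (hc : ∀ m ∈ border B, ∃ f ∈ F, IsLeading B f m) (i : Fin n) :
    Module.End ℝ (monSpan B) :=
  (rewriteStep F B ∘ₗ LinearMap.mulLeft ℝ (X i) ∘ₗ (monSpan B).subtype).codRestrict (monSpan B)
    fun p => rewriteStep_mem hF hc (X_mul_mem_monSpan_prolong i p.2)

theorem coe_mulOp {F : Set (Poly n)} {B : Set (Mon n)} (hF : IsRewritingFamily F B)
    (hc : ∀ m ∈ border B, ∃ f ∈ F, IsLeading B f m) (i : Fin n) (p : monSpan B) :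
    (mulOp hF hc i p : Poly n) = rewriteStep F B (X i * (p : Poly n)) := rfl

theorem mem_spanD_of_mem_span {F : Set (Poly n)} {d : ℕ} (hd : ∀ g ∈ F, g.totalDegree ≤ d)
    {p : Poly n} (hp : p ∈ Submodule.span ℝ F) : p ∈ spanD F d := by
  have : Submodule.span ℝ F ≤ spanD F d := by
    refine Submodule.span_le.2 fun g hg => Submodule.subset_span ⟨g, hg, 0, ?_, ?_⟩
    · simpa using hd g hg
    · rw [monomial_zero', C_1, one_mul]
  exact this hp

theorem X_mul_mem_spanD_of_mem_span {F : Set (Poly n)} {d : ℕ}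
    (hd : ∀ g ∈ F, g.totalDegree + 1 ≤ d) (i : Fin n) {p : Poly n}
    (hp : p ∈ Submodule.span ℝ F) : X i * p ∈ spanD F d := by
  have : (Submodule.span ℝ F).map (LinearMap.mulLeft ℝ (X i)) ≤ spanD F d := by
    rw [Submodule.map_span_le]
    intro g hg
    refine Submodule.subset_span ⟨g, hg, Finsupp.single i 1, ?_, rfl⟩
    rw [Finsupp.degree_single, add_comm]
    exact hd g hg
  exact this ⟨p, hp, rfl⟩

/-- The difference of the two sides is in `⟨B⟩`, and it is in `⟨F | d⟩` because
`xᵢ xⱼ b - ρ(xᵢ ρ(xⱼ b))` is. -/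
theorem commute_mulOp {F : Set (Poly n)} {B : Set (Mon n)} (hF : IsRewritingFamily F B)
    (hc : ∀ m ∈ border B, ∃ f ∈ F, IsLeading B f m) {d : ℕ}
    (hd : ∀ g ∈ F, g.totalDegree + 1 ≤ d) (hdisj : Disjoint (monSpan B) (spanD F d))
    (i j : Fin n) : mulOp hF hc i * mulOp hF hc j = mulOp hF hc j * mulOp hF hc i := by
  have key : ∀ (i j : Fin n) (p : monSpan B),
      X i * (X j * (p : Poly n)) - (mulOp hF hc i (mulOp hF hc j p) : Poly n) ∈ spanD F d := by
    intro i j p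
    rw [coe_mulOp, coe_mulOp]
    have h1 := X_mul_mem_spanD_of_mem_span hd i (sub_rewriteStep_mem_span F B (X j * (p : Poly n)))
    have h2 := mem_spanD_of_mem_span (fun g hg => (Nat.le_succ _).trans (hd g hg))
      (sub_rewriteStep_mem_span F B (X i * rewriteStep F B (X j * (p : Poly n))))
    convert add_mem h1 h2 using 1
    ring
  ext p : 2
  rw [Module.End.mul_apply, Module.End.mul_apply, ← sub_eq_zero]
  refine (Submodule.disjoint_def.1 hdisj) _ (sub_mem (Subtype.coe_prop _) (Subtype.coe_prop _)) ?_
  have := sub_mem (key j i p) (key i j p)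
  convert this using 1
  ring

/-- The commuting operators `M_i` make `⟨B⟩` an `ℝ[x]`-module; the map `p ↦ p(M)(1)` is the identity
on `⟨B⟩`, since `B` is connected to `1`, and vanishes on the ideal `(F)`. -/
theorem disjoint_monSpan_ideal {F : Set (Poly n)} {B : Set (Mon n)} (hF : IsRewritingFamily F B)
    (hc : ∀ m ∈ border B, ∃ f ∈ F, IsLeading B f m) (hB : ConnectedToOne B) {d : ℕ}
    (hd : ∀ g ∈ F, g.totalDegree + 1 ≤ d) (hdisj : Disjoint (monSpan B) (spanD F d)) :
    Disjoint (monSpan B) ((Ideal.span F).restrictScalars ℝ) := by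
  set M := mulOp hF hc with hM
  have hcomm : ∀ a ∈ Set.range M, ∀ b ∈ Set.range M, a * b = b * a := by
    rintro _ ⟨i, rfl⟩ _ ⟨j, rfl⟩
    exact commute_mulOp hF hc hd hdisj i j
  have := Algebra.isMulCommutative_adjoin ℝ hcomm
  open scoped IsMulCommutative in
  let φ : Poly n →ₐ[ℝ] Algebra.adjoin ℝ (Set.range M) :=
    aeval fun i => ⟨M i, Algebra.subset_adjoin ⟨i, rfl⟩⟩
  let Φ : Poly n →ₐ[ℝ] Module.End ℝ (monSpan B) := (Subalgebra.val _).comp φ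
  have hΦX : ∀ i, Φ (X i) = M i := fun i => by simp [Φ, φ]
  let e : monSpan B := ⟨1, one_mem_monSpan hB.1⟩
  let Ψ : Poly n →ₗ[ℝ] Poly n := (monSpan B).subtype ∘ₗ (LinearMap.applyₗ e) ∘ₗ Φ.toLinearMap
  have hΨ : ∀ p, Ψ p = (Φ p e : Poly n) := fun p => rfl
  have hΨX : ∀ i p, Ψ (X i * p) = rewriteStep F B (X i * Ψ p) := fun i p => by
    rw [hΨ, map_mul, hΦX, Module.End.mul_apply, hM, coe_mulOp, ← hΨ]
  -- induction on the degree, along a path from `1` to `b` inside `B`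
  have hB' : ∀ k, ∀ b ∈ B, b.degree = k → Ψ (monomial b 1) = monomial b 1 := by
    intro k
    induction k with
    | zero =>
      intro b hb hk
      rw [Finsupp.degree_eq_zero_iff] at hk
      subst hk
      change Ψ 1 = 1
      rw [hΨ, map_one]
      rfl
    | succ k ih =>
      intro b hb hk
      have hb0 : b ≠ 0 := by rintro rfl; simp at hk
      obtain ⟨i, b', hb', rfl⟩ := hB.2 b hb hb0
      have hdeg : b'.degree = k := by
        rw [map_add, Finsupp.degree_single] at hk
        omega
      have h1 : (monomial (Finsupp.single i 1 + b') 1 : Poly n) = X i * monomial b' 1 := by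
        rw [X, monomial_mul, one_mul]
      rw [h1, hΨX, ih b' hb' hdeg, ← h1, rewriteStep_eq_self (monomial_mem_monSpan hb)]
  have hΨB : ∀ p ∈ monSpan B, Ψ p = p := by
    intro p hp
    refine LinearMap.eqOn_span (f := Ψ) (g := LinearMap.id) ?_ hp
    rintro _ ⟨m, hm, rfl⟩
    exact hB' _ m hm rfl
  have hΨp : ∀ p ∈ monSpan (prolong B), Ψ p = rewriteStep F B p := by
    intro p hp
    refine LinearMap.eqOn_span ?_ hp
    rintro _ ⟨m, hm, rfl⟩
    simp only
    obtain hm | ⟨b, hb, i, rfl⟩ := hm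
    · rw [hΨB _ (monomial_mem_monSpan hm), rewriteStep_eq_self (monomial_mem_monSpan hm)]
    · have h1 : (monomial (Finsupp.single i 1 + b) 1 : Poly n) = X i * monomial b 1 := by
        rw [X, monomial_mul, one_mul]
      rw [h1, hΨX, hB' _ b hb rfl]
  have hΨF : ∀ g ∈ F, Ψ g = 0 := by
    intro g hg
    have hgB := mem_monSpan_of_support_subset (hF.support_subset g hg)
    have h1 := hΨp g hgB
    refine (Submodule.disjoint_def.1 hdisj) _ (Subtype.coe_prop _) ?_
    have h2 : ∀ p ∈ Submodule.span ℝ F, p ∈ spanD F d := fun p hp =>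
      mem_spanD_of_mem_span (fun g hg => (Nat.le_succ _).trans (hd g hg)) hp
    have h3 := sub_mem (h2 g (Submodule.subset_span hg)) (h2 _ (sub_rewriteStep_mem_span F B g))
    rwa [sub_sub_cancel, ← h1] at h3
  have hker : ∀ p ∈ Ideal.span F, Ψ p = 0 := by
    intro p hp
    induction hp using Submodule.span_induction with
    | mem p hp => exact hΨF p hp
    | zero => exact map_zero Ψ
    | add p q _ _ hp hq => rw [map_add, hp, hq, add_zero]
    | smul a p _ hp =>
      have h1 : Φ p e = 0 := Subtype.ext hp
      rw [hΨ, smul_eq_mul, map_mul, Module.End.mul_apply, h1, map_zero]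
      rfl
  rw [Submodule.disjoint_def]
  intro p hpB hpF
  rw [← hΨB p hpB]
  exact hker p hpF

/-! ### Finite-dimensional algebras with a positive definite form -/

section PositiveDefinite

variable {A : Type*} [CommRing A] [Algebra ℝ A] {Λ : A →ₗ[ℝ] ℝ}

theorem isReduced_of_posDef (hdef : ∀ a, Λ (a * a) = 0 → a = 0) : IsReduced A := by
  refine (isReduced_iff_pow_one_lt 2 one_lt_two).2 fun a ha => hdef a ?_
  rw [← sq, ha, map_zero]

/-- The residue fields are `ℝ` or `ℂ`. In a residue field `ℂ`, with idempotent `u`, the square of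
`u √-1` is `-u²`, on which a positive definite form would be negative. -/
theorem exists_algHom_ker_eq_of_posDef [FiniteDimensional ℝ A] (hpos : ∀ a, 0 ≤ Λ (a * a))
    (hdef : ∀ a, Λ (a * a) = 0 → a = 0) (M : MaximalSpectrum A) :
    ∃ χ : A →ₐ[ℝ] ℝ, ∀ a, χ a = 0 ↔ a ∈ M.asIdeal := by
  classical
  have : IsArtinianRing A := IsArtinianRing.of_finite ℝ A
  have : IsReduced A := isReduced_of_posDef hdef
  have := M.isMaximal
  let : Field (A ⧸ M.asIdeal) := Ideal.Quotient.field _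
  have : FiniteDimensional ℝ (A ⧸ M.asIdeal) :=
    Module.Finite.of_surjective (Ideal.Quotient.mkₐ ℝ M.asIdeal).toLinearMap
      (Ideal.Quotient.mkₐ_surjective ℝ _)
  have : Algebra.IsAlgebraic ℝ (A ⧸ M.asIdeal) := Algebra.IsAlgebraic.of_finite _ _
  obtain ⟨⟨e⟩⟩ | ⟨⟨e⟩⟩ := Real.nonempty_algEquiv_or (A ⧸ M.asIdeal)
  · refine ⟨(e : (A ⧸ M.asIdeal) →ₐ[ℝ] ℝ).comp (Ideal.Quotient.mkₐ ℝ M.asIdeal), fun a => ?_⟩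
    simp [Ideal.Quotient.eq_zero_iff_mem]
  · exfalso
    obtain ⟨j, hj⟩ := Ideal.Quotient.mk_surjective (e.symm Complex.I)
    obtain ⟨u, hu⟩ := (IsArtinianRing.equivPi A).surjective (Pi.single M 1)
    have hj2 : (Ideal.Quotient.mk M.asIdeal j) * (Ideal.Quotient.mk M.asIdeal j) = -1 := by
      rw [hj, ← map_mul, Complex.I_mul_I, map_neg, map_one]
    have hw : u * j * (u * j) + u * u = 0 := by
      apply (IsArtinianRing.equivPi A).injective
      rw [map_zero, map_add, map_mul, map_mul, map_mul, hu]
      ext N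
      obtain rfl | hN := eq_or_ne N M
      · simp only [Pi.add_apply, Pi.mul_apply, Pi.single_eq_same, IsArtinianRing.equivPi_apply,
          one_mul, Pi.zero_apply]
        rw [hj2, neg_add_cancel]
      · simp [Pi.single_eq_of_ne hN]
    have hΛ : Λ (u * j * (u * j)) + Λ (u * u) = 0 := by rw [← map_add, hw, map_zero]
    have hu0 : u = 0 := hdef u (by linarith [hpos (u * j), hpos u])
    have := congrFun hu M
    rw [hu0, map_zero, Pi.single_eq_same, Pi.zero_apply] at this
    exact zero_ne_one this

theorem eq_zero_of_forall_algHom_of_posDef [FiniteDimensional ℝ A] (hpos : ∀ a, 0 ≤ Λ (a * a))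
    (hdef : ∀ a, Λ (a * a) = 0 → a = 0) {a : A} (ha : ∀ χ : A →ₐ[ℝ] ℝ, χ a = 0) : a = 0 := by
  have : IsArtinianRing A := IsArtinianRing.of_finite ℝ A
  have : IsReduced A := isReduced_of_posDef hdef
  apply (IsArtinianRing.equivPi A).injective
  rw [map_zero]
  ext M
  obtain ⟨χ, hχ⟩ := exists_algHom_ker_eq_of_posDef hpos hdef M
  rw [IsArtinianRing.equivPi_apply]
  exact Ideal.Quotient.eq_zero_iff_mem.2 ((hχ a).1 (ha χ))

/-- Under the isomorphism of `A` with a power of `ℝ`, square roots are taken coordinatewise. -/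
theorem exists_mul_self_of_posDef [FiniteDimensional ℝ A] (hpos : ∀ a, 0 ≤ Λ (a * a))
    (hdef : ∀ a, Λ (a * a) = 0 → a = 0) {a : A} (ha : ∀ χ : A →ₐ[ℝ] ℝ, 0 ≤ χ a) :
    ∃ b, a = b * b := by
  have : IsArtinianRing A := IsArtinianRing.of_finite ℝ A
  have : IsReduced A := isReduced_of_posDef hdef
  choose χ hχ using exists_algHom_ker_eq_of_posDef hpos hdef
  obtain ⟨b, hb⟩ := (IsArtinianRing.equivPi A).surjective
    fun M => Ideal.Quotient.mk M.asIdeal (algebraMap ℝ A (Real.sqrt (χ M a)))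
  refine ⟨b, (IsArtinianRing.equivPi A).injective ?_⟩
  rw [map_mul, hb]
  ext M
  rw [IsArtinianRing.equivPi_apply, Pi.mul_apply, ← map_mul, ← map_mul,
    Real.mul_self_sqrt (ha (χ M)), Ideal.Quotient.mk_eq_mk_iff_sub_mem, ← hχ M,
    map_sub, AlgHom.commutes, sub_eq_zero]
  rfl

/-- `Λ` is a combination with positive coefficients of the characters of `A`, so that it vanishes on
an element that is nonnegative at all characters only if that element is `0`. -/
theorem eq_zero_of_posDef [FiniteDimensional ℝ A] (hpos : ∀ a, 0 ≤ Λ (a * a))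
    (hdef : ∀ a, Λ (a * a) = 0 → a = 0) {a : A} (ha : ∀ χ : A →ₐ[ℝ] ℝ, 0 ≤ χ a)
    (hΛ : Λ a = 0) : a = 0 := by
  obtain ⟨b, rfl⟩ := exists_mul_self_of_posDef hpos hdef ha
  rw [hdef b hΛ, mul_zero]

end PositiveDefinite

/-! ### Truncated Hankel operators -/

theorem hankel_apply {E : Submodule ℝ (Poly n)} (Λ : Module.Dual ℝ ↥(E * E)) (p q : E) :
    hankel E Λ p q = Λ ⟨(p : Poly n) * q, Submodule.mul_mem_mul p.2 q.2⟩ := rfl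

theorem hankel_isSymm {E : Submodule ℝ (Poly n)} (Λ : Module.Dual ℝ ↥(E * E)) :
    LinearMap.IsSymm (hankel E Λ) where
  eq p q := by
    rw [RingHom.id_apply, hankel_apply, hankel_apply]
    congr 2
    exact mul_comm _ _

theorem mem_ker_hankel_iff {G : Set (Poly n)} {E : Submodule ℝ (Poly n)}
    {Λ : Module.Dual ℝ ↥(E * E)} (hΛ : Λ ∈ feasible G E) (p : E) :
    p ∈ LinearMap.ker (hankel E Λ) ↔ hankel E Λ p p = 0 :=
  (LinearMap.BilinForm.apply_apply_same_eq_zero_iff (hankel E Λ) hΛ.2.2 (hankel_isSymm Λ)).symm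

/-- By positivity, `p ∈ E₀` is in the kernel of `H_Λ^{E₀}` if and only if `Λ(p²) = 0`, a condition
that does not depend on `E₀`; so the kernel of `H_Λ^{E₀}` is `E₀ ∩ ker H_Λ^E`. -/
theorem mem_hankelKer_iff {G : Set (Poly n)} {E₀ E : Submodule ℝ (Poly n)} (h : E₀ ≤ E)
    {Λ : Module.Dual ℝ ↥(E * E)} (hΛ : Λ ∈ feasible G E) (p : Poly n) :
    p ∈ hankelKer h Λ ↔ ∃ hp : p ∈ E₀, hankel E Λ ⟨p, h hp⟩ ⟨p, h hp⟩ = 0 := by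
  constructor
  · rintro ⟨q, hq, rfl⟩
    exact ⟨q.2, LinearMap.congr_fun (LinearMap.mem_ker.1 hq) q⟩
  · rintro ⟨hp, hp0⟩
    refine ⟨⟨p, hp⟩, ?_, rfl⟩
    rw [← mem_ker_hankel_iff hΛ] at hp0
    rw [SetLike.mem_coe, LinearMap.mem_ker]
    ext q
    exact LinearMap.congr_fun (LinearMap.mem_ker.1 hp0) ⟨q, h q.2⟩

/-- If `Λ` is generic among the optimal forms, then its kernel is the least one: the kernel for the
optimal form `(Λ + Λ') / 2` is the intersection of those for `Λ` and `Λ'`. -/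
theorem ker_hankel_le_of_isOptimalLinearForm {G : Set (Poly n)} {E : Submodule ℝ (Poly n)}
    [FiniteDimensional ℝ E] {p : ↥(E * E)} {Λ Λ' : Module.Dual ℝ ↥(E * E)}
    (hΛ : IsOptimalLinearForm G E p Λ) (hΛ' : Λ' ∈ minForms G E p) :
    LinearMap.ker (hankel E Λ) ≤ LinearMap.ker (hankel E Λ') := by
  obtain ⟨⟨hf, hv⟩, hgen⟩ := hΛ
  obtain ⟨hf', hv'⟩ := hΛ'
  set Λ₂ : Module.Dual ℝ ↥(E * E) := (2⁻¹ : ℝ) • (Λ + Λ') with hΛ₂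
  have happ : ∀ q r, hankel E Λ₂ q r = 2⁻¹ * (hankel E Λ q r + hankel E Λ' q r) :=
    fun _ _ => rfl
  have hval : ∀ g, Λ₂ g = 2⁻¹ * (Λ g + Λ' g) := fun _ => rfl
  have hf₂ : Λ₂ ∈ feasible G E := by
    refine ⟨fun g hg => ?_, ?_, fun q => ?_⟩
    · rw [hval, hf.1 g hg, hf'.1 g hg, add_zero, mul_zero]
    · obtain ⟨h, h1⟩ := hf.2.1
      obtain ⟨_, h1'⟩ := hf'.2.1
      refine ⟨h, ?_⟩
      rw [hval, h1, h1']
      norm_num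
    · rw [happ]
      have := hf.2.2 q
      have := hf'.2.2 q
      positivity
  have hmin : Λ₂ ∈ minForms G E p := by
    refine ⟨hf₂, ?_⟩
    have h1 : Λ p = Λ' p := EReal.coe_injective (hv.trans hv'.symm)
    have h2 : Λ₂ p = Λ p := by rw [hval, ← h1]; ring
    rw [h2, hv]
  have hle : ∀ q, q ∈ LinearMap.ker (hankel E Λ₂) →
      q ∈ LinearMap.ker (hankel E Λ) ∧ q ∈ LinearMap.ker (hankel E Λ') := by
    intro q hq
    rw [mem_ker_hankel_iff hf₂, happ] at hq
    rw [mem_ker_hankel_iff hf, mem_ker_hankel_iff hf']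
    have := hf.2.2 q
    have := hf'.2.2 q
    constructor <;> linarith
  have hrank := hgen Λ₂ hmin
  rw [LinearMap.rank, LinearMap.rank, ← Module.finrank_eq_rank, ← Module.finrank_eq_rank,
    Nat.cast_le] at hrank
  have h1 := LinearMap.finrank_range_add_finrank_ker (hankel E Λ)
  have h2 := LinearMap.finrank_range_add_finrank_ker (hankel E Λ₂)
  have heq : LinearMap.ker (hankel E Λ₂) = LinearMap.ker (hankel E Λ) :=
    Submodule.eq_of_le_of_finrank_le (fun q hq => (hle q hq).1) (by omega)
  exact fun q hq => (hle q (heq ▸ hq)).2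

/-- The evaluation at `x`, as a linear form on `⟨E · E⟩`. -/
def evalForm (E : Submodule ℝ (Poly n)) (x : Fin n → ℝ) : Module.Dual ℝ ↥(E * E) :=
  (aeval x : Poly n →ₐ[ℝ] ℝ).toLinearMap ∘ₗ (E * E).subtype

theorem evalForm_apply (E : Submodule ℝ (Poly n)) (x : Fin n → ℝ) (p : ↥(E * E)) :
    evalForm E x p = aeval x (p : Poly n) := rfl

theorem hankel_evalForm (E : Submodule ℝ (Poly n)) (x : Fin n → ℝ) (p q : E) :
    hankel E (evalForm E x) p q = aeval x (p : Poly n) * aeval x (q : Poly n) :=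
  map_mul (aeval x) _ _

theorem relations_subset_ideal (F : Set (Poly n)) (B M : Set (Mon n)) :
    relations F B M ⊆ Ideal.span F := by
  have : Submodule.span ℝ ({g | ∃ b ∈ M, ∃ b' ∈ M,
      g = monomial (b + b') 1 - proj F B (monomial (b + b') 1)} ∩ ↑(monSpan M * monSpan M)) ≤
      (Ideal.span F).restrictScalars ℝ := by
    refine Submodule.span_le.2 ?_
    rintro _ ⟨⟨b, _, b', _, rfl⟩, -⟩
    exact sub_proj_mem_ideal F B _
  exact this

theorem evalForm_mem_feasible {F : Set (Poly n)} (B : Set (Mon n)) {M : Set (Mon n)} (h0 : 0 ∈ M)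
    {x : Fin n → ℝ} (hx : ∀ p ∈ Ideal.span F, aeval x p = 0) :
    evalForm (monSpan M) x ∈ feasible (relations F B M) (monSpan M) := by
  refine ⟨fun g hg => hx _ (relations_subset_ideal F B M hg), ⟨?_, ?_⟩, fun p => ?_⟩
  · simpa using Submodule.mul_mem_mul (one_mem_monSpan h0) (one_mem_monSpan (n := n) h0)
  · exact map_one (aeval x)
  · rw [hankel_evalForm]
    exact mul_self_nonneg _

/-! ### The relations kept by the algorithm vanish at the minimizers -/

theorem mem_minimizerIdeal {f p : Poly n} :
    p ∈ minimizerIdeal f ↔ ∀ x ∈ minimizers f, aeval x p = 0 :=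
  mem_vanishingIdeal_iff

/-- The chain rule for the restriction of `f` to the line through `x` in direction `i`. -/
theorem derivative_aeval_line (x : Fin n → ℝ) (i : Fin n) (f : Poly n) :
    Polynomial.derivative (aeval (fun j => Polynomial.C (x j) +
      Polynomial.C (Pi.single (M := fun _ => ℝ) i 1 j) * Polynomial.X) f) =
    aeval (fun j => Polynomial.C (x j) +
      Polynomial.C (Pi.single (M := fun _ => ℝ) i 1 j) * Polynomial.X) (pderiv i f) := by
  induction f using MvPolynomial.induction_on with
  | C a => simp
  | add p q hp hq => simp only [map_add, hp, hq]
  | mul_X p j hp =>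
    rw [map_mul, Polynomial.derivative_mul, hp, pderiv_mul, map_add, map_mul, map_mul, aeval_X,
      pderiv_X]
    congr 2
    obtain rfl | hij := eq_or_ne i j
    · simp
    · simp [Pi.single_eq_of_ne hij.symm]

theorem pderiv_mem_minimizerIdeal (f : Poly n) (i : Fin n) :
    pderiv i f ∈ minimizerIdeal f := by
  rw [mem_minimizerIdeal]
  intro x hx
  set y : Fin n → Polynomial ℝ := fun j => Polynomial.C (x j) +
      Polynomial.C (Pi.single (M := fun _ => ℝ) i 1 j) * Polynomial.X with hy
  have heval : ∀ (p : Poly n) (r : ℝ),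
      (aeval y p).eval r = eval (fun j => (y j).eval r) p := by
    intro p r
    rw [← Polynomial.coe_evalRingHom, aeval_def, hom_eval₂, eval, coe_eval₂Hom]
    congr 1
    ext
    simp
  have h0 : (fun j => (y j).eval 0) = x := by
    ext j
    simp [hy]
  have hmin : IsLocalMin (fun r => (aeval y f).eval r) 0 := by
    refine Filter.Eventually.of_forall fun r => ?_
    simp only [heval, h0]
    exact hx _
  have h1 := hmin.hasDerivAt_eq_zero ((aeval y f).hasDerivAt 0)
  rwa [derivative_aeval_line, heval, h0] at h1

theorem commRelations_subset_ideal (F : Set (Poly n)) (B : Set (Mon n)) :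
    commRelations F B ⊆ Ideal.span F := by
  rintro _ ⟨f, hf, f', hf', _, _, _, _, m, -, m', -, -, rfl⟩
  exact sub_mem (Ideal.mul_mem_left _ _ (Ideal.subset_span hf))
    (Ideal.mul_mem_left _ _ (Ideal.subset_span hf'))

theorem IsUpdate.subset_ideal {s : State n} {F : Set (Poly n)} {B : Set (Mon n)}
    (h : IsUpdate s F B) {I : Ideal (Poly n)} (hI : s.F ⊆ I) : F ⊆ I := by
  obtain ⟨R, hR, -, -, hF, -⟩ := h
  refine hF.trans (Ideal.span_le.2 (Set.union_subset hI fun r hr => ?_))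
  obtain ⟨-, c, hc, hcr, -⟩ := hR.1 r hr
  have hle : Ideal.span s.F ≤ I := Ideal.span_le.2 hI
  have := sub_mem (hle (commRelations_subset_ideal s.F s.B hc.1))
    (hle (spanD_le_ideal s.F _ hcr))
  rwa [sub_sub_cancel] at this

theorem LoopStep.subset_ideal {f : Poly n} {s s' : State n} (h : LoopStep f s s')
    {I : Ideal (Poly n)} (hI : s.F ⊆ I) : s'.F ⊆ I := by
  cases h with
  | gap hu => exact hu.subset_ideal hI
  | newValue hg => exact hg.update.subset_ideal hI
  | largeDegree hb => exact hb.noGap.update.subset_ideal hI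
  | testFails hs => exact hs.basisComputed.noGap.update.subset_ideal hI
  | noBasis hg => exact hg.update.subset_ideal hI
  | noSecondForm hb => exact hb.noGap.update.subset_ideal hI

theorem state_subset_minimizerIdeal {f : Poly n} {s : State n}
    (h : Relation.ReflTransGen (LoopStep f) (initState f) s) :
    s.F ⊆ minimizerIdeal f := by
  induction h with
  | refl =>
    rintro _ ⟨i, rfl⟩
    exact pderiv_mem_minimizerIdeal f i
  | tail _ h ih => exact h.subset_ideal ih

/-! ### The border basis computed when the algorithm stops -/

/-- If `deg b + 2 ≤ d` for all `b ∈ B`, then the commutation relations that a border basis in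
degree `≤ d` satisfies are all those needed for a border basis. -/
theorem IsBorderBasisInDegree.isBorderBasis {F : Set (Poly n)} {B : Set (Mon n)} {d : ℕ}
    (h : IsBorderBasisInDegree F B d) (hB : ∀ b ∈ B, b.degree + 2 ≤ d) :
    IsBorderBasis F B ∧ ∀ m ∈ border B, ∃ f ∈ F, IsLeading B f m := by
  have hborder : ∀ m ∈ border B, m.degree + 1 ≤ d := by
    rintro m ⟨hm | ⟨b, hb, i, rfl⟩, hmB⟩
    · exact absurd hm hmB
    · rw [map_add, Finsupp.degree_single]
      have := hB b hb
      omega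
  have hc : ∀ m ∈ border B, ∃ f ∈ F, IsLeading B f m := fun m hm =>
    h.complete.complete m hm (by have := hborder m hm; omega)
  have hF := h.complete.rewriting
  have hdeg : ∀ g ∈ F, g.totalDegree + 1 ≤ d := by
    intro g hg
    obtain ⟨μ, hμ⟩ := hF.leading g hg
    rw [← h.complete.graded g hg μ hμ]
    exact hborder μ hμ.1
  have htrunc : truncMon B d = B :=
    Set.Subset.antisymm (truncMon_subset B d) fun b hb => ⟨hb, by have := hB b hb; omega⟩
  have hdisj := h.disjoint
  rw [htrunc] at hdisj
  refine ⟨⟨h.connected, fun _ => ⟨hF, h.complete.graded, fun m hm _ => hc m hm⟩, ?_⟩, hc⟩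
  exact ⟨disjoint_monSpan_ideal hF hc h.connected hdeg hdisj,
    codisjoint_iff.2 (monSpan_sup_ideal_eq_top hF hc h.connected.1)⟩

theorem sub_proj_mem_relations {F : Set (Poly n)} {B : Set (Mon n)} (hF : IsRewritingFamily F B)
    (hc : ∀ m ∈ border B, ∃ f ∈ F, IsLeading B f m) (h0 : 0 ∈ B) {p : Poly n}
    (hp : p ∈ monSpan B * monSpan B) : p - proj F B p ∈ relations F B B := by
  have hle : monSpan B ≤ monSpan B * monSpan B := fun p hp => by
    simpa using Submodule.mul_mem_mul hp (one_mem_monSpan (n := n) h0)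
  have : (monSpan B * monSpan B).map (LinearMap.id - proj F B) ≤
      Submodule.span ℝ ({g | ∃ b ∈ B, ∃ b' ∈ B,
        g = monomial (b + b') 1 - proj F B (monomial (b + b') 1)} ∩
        ↑(monSpan B * monSpan B)) := by
    conv_lhs => rw [monSpan, Submodule.span_mul_span]
    rw [Submodule.map_span_le]
    rintro _ ⟨_, ⟨b, hb, rfl⟩, _, ⟨b', hb', rfl⟩, rfl⟩
    simp only [monomial_mul, one_mul]
    refine Submodule.subset_span ⟨⟨b, hb, b', hb', rfl⟩, ?_⟩
    refine sub_mem ?_ (hle (proj_mem hF hc h0 _))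
    have := Submodule.mul_mem_mul (monomial_mem_monSpan hb) (monomial_mem_monSpan hb')
    rwa [monomial_mul, one_mul] at this
  exact this ⟨p, hp, rfl⟩

/-- For a border basis, `Λ ∘ π_{F,B}` extends a feasible `Λ` with injective Hankel operator to a
positive definite form on `ℝ[x] / (F)`. -/
theorem exists_posDef_form {F : Set (Poly n)} {B : Set (Mon n)} (hbb : IsBorderBasis F B)
    (hc : ∀ m ∈ border B, ∃ f ∈ F, IsLeading B f m)
    {Λ : Module.Dual ℝ ↥(monSpan B * monSpan B)}
    (hΛ : Λ ∈ feasible (relations F B B) (monSpan B))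
    (hker : ∀ p, hankel (monSpan B) Λ p p = 0 → p = 0) :
    ∃ L : (Poly n ⧸ Ideal.span F) →ₗ[ℝ] ℝ, (∀ a, 0 ≤ L (a * a)) ∧
      (∀ a, L (a * a) = 0 → a = 0) ∧
      ∀ p : ↥(monSpan B * monSpan B), L (Ideal.Quotient.mk _ (p : Poly n)) = Λ p := by
  have hF := (hbb.complete 0).rewriting
  have h0 := hbb.connected.1
  have hle : monSpan B ≤ monSpan B * monSpan B := fun p hp => by
    simpa using Submodule.mul_mem_mul hp (one_mem_monSpan (n := n) h0)
  let Λ₁ : Poly n →ₗ[ℝ] ℝ :=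
    Λ ∘ₗ (proj F B).codRestrict (monSpan B * monSpan B) fun p => hle (proj_mem hF hc h0 p)
  have hΛ₁ : (Ideal.span F).restrictScalars ℝ ≤ LinearMap.ker Λ₁ := by
    intro p hp
    have h1 : proj F B p = 0 := by
      refine Submodule.disjoint_def.1 hbb.isCompl.disjoint _ (proj_mem hF hc h0 p) ?_
      have := sub_mem hp (sub_proj_mem_ideal F B p)
      rwa [sub_sub_cancel] at this
    have h2 : (proj F B).codRestrict (monSpan B * monSpan B)
        (fun p => hle (proj_mem hF hc h0 p)) p = 0 := Subtype.ext h1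
    rw [LinearMap.mem_ker, LinearMap.comp_apply, h2, map_zero]
  let L : (Poly n ⧸ Ideal.span F) →ₗ[ℝ] ℝ := Submodule.liftQ _ Λ₁ hΛ₁ ∘ₗ
    (Submodule.Quotient.restrictScalarsEquiv ℝ (Ideal.span F)).symm.toLinearMap
  have hL : ∀ p, L (Ideal.Quotient.mk _ p) = Λ₁ p := fun p => rfl
  have hLΛ : ∀ p : ↥(monSpan B * monSpan B), L (Ideal.Quotient.mk _ (p : Poly n)) = Λ p := by
    intro p
    rw [hL, eq_comm, ← sub_eq_zero, LinearMap.comp_apply, ← map_sub]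
    exact hΛ.1 _ (sub_proj_mem_relations hF hc h0 p.2)
  have hrep : ∀ a : Poly n ⧸ Ideal.span F, ∃ q : monSpan B,
      a = Ideal.Quotient.mk _ (q : Poly n) ∧ L (a * a) = hankel (monSpan B) Λ q q := by
    intro a
    obtain ⟨p, rfl⟩ := Ideal.Quotient.mk_surjective a
    have h1 : Ideal.Quotient.mk (Ideal.span F) p = Ideal.Quotient.mk _ (proj F B p) :=
      Ideal.Quotient.mk_eq_mk_iff_sub_mem _ _ |>.2 (sub_proj_mem_ideal F B p)
    refine ⟨⟨proj F B p, proj_mem hF hc h0 p⟩, h1, ?_⟩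
    rw [h1, ← map_mul, hankel_apply, ← hLΛ]
  refine ⟨L, fun a => ?_, fun a ha => ?_, hLΛ⟩
  · obtain ⟨q, -, hq⟩ := hrep a
    rw [hq]
    exact hΛ.2.2 q
  · obtain ⟨q, rfl, hq⟩ := hrep a
    rw [hker q (hq ▸ ha), Submodule.coe_zero, map_zero]

theorem finiteDimensional_quotient {F : Set (Poly n)} {B : Set (Mon n)}
    (hbb : IsBorderBasis F B) : FiniteDimensional ℝ (Poly n ⧸ Ideal.span F) := by
  have := finiteDimensional_monSpan (n := n) (hbb.complete 0).rewriting.finite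
  refine Module.Finite.of_surjective
    ((Ideal.Quotient.mkₐ ℝ (Ideal.span F)).toLinearMap ∘ₗ (monSpan B).subtype) fun a => ?_
  obtain ⟨p, rfl⟩ := Ideal.Quotient.mk_surjective a
  obtain ⟨q, hq, r, hr, rfl⟩ := Submodule.mem_sup.1
    (hbb.isCompl.sup_eq_top ▸ Submodule.mem_top (x := p))
  refine ⟨⟨q, hq⟩, ?_⟩
  rw [map_add, Ideal.Quotient.eq_zero_iff_mem.2 hr, add_zero]
  rfl

/-- The characters of `ℝ[x] / (F)` are the evaluations at the real zeros of `F`. -/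
theorem exists_point_of_algHom {I : Ideal (Poly n)} (χ : (Poly n ⧸ I) →ₐ[ℝ] ℝ) :
    ∃ x : Fin n → ℝ, (∀ p, χ (Ideal.Quotient.mk I p) = aeval x p) ∧ ∀ p ∈ I, aeval x p = 0 := by
  have h : ∀ p, χ (Ideal.Quotient.mk I p) =
      aeval (fun i => χ (Ideal.Quotient.mk I (X i))) p := by
    have : χ.comp (Ideal.Quotient.mkₐ ℝ I) =
        aeval (fun i => χ (Ideal.Quotient.mk I (X i))) := by
      ext i
      simp
    exact fun p => DFunLike.congr_fun this p
  refine ⟨_, h, fun p hp => ?_⟩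
  rw [← h, Ideal.Quotient.eq_zero_iff_mem.2 hp, map_zero]

theorem aeval_eq_of_represents {F : Set (Poly n)} {d : ℕ} {E : Submodule ℝ (Poly n)} {f : Poly n}
    {p : ↥(E * E)} (h : Represents F d f p) {x : Fin n → ℝ}
    (hx : ∀ q ∈ Ideal.span F, aeval x q = 0) : aeval x (p : Poly n) = aeval x f := by
  have := hx _ (spanD_le_ideal F d h)
  rw [map_sub, sub_eq_zero] at this
  exact this.symm

theorem muValue_le_aeval {F : Set (Poly n)} (B : Set (Mon n)) {M : Set (Mon n)} (h0 : 0 ∈ M)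
    {d : ℕ} {f : Poly n} {p : ↥(monSpan M * monSpan M)} (h : Represents F d f p)
    {x : Fin n → ℝ} (hx : ∀ q ∈ Ideal.span F, aeval x q = 0) :
    muValue (relations F B M) (monSpan M) p ≤ ((aeval x f : ℝ) : EReal) := by
  rw [← aeval_eq_of_represents h hx, ← evalForm_apply]
  exact iInf₂_le _ (evalForm_mem_feasible B h0 hx)

/-- The ideal of a border basis, from a form `Λ` that reaches the relaxed minimum `c` of `f` and has
injective Hankel operator: `(F)` is the vanishing ideal of its real zeros, of which there is at
least one, and `f = c` at all of them. -/
theorem realRadical_of_optimal {F : Set (Poly n)} {B : Set (Mon n)} (hbb : IsBorderBasis F B)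
    (hc : ∀ m ∈ border B, ∃ f ∈ F, IsLeading B f m) {d : ℕ} {f : Poly n}
    {p : ↥(monSpan B * monSpan B)} (hp : Represents F d f p)
    {Λ : Module.Dual ℝ ↥(monSpan B * monSpan B)}
    (hΛ : Λ ∈ minForms (relations F B B) (monSpan B) p)
    (hker : ∀ p, hankel (monSpan B) Λ p p = 0 → p = 0) :
    (∃ x : Fin n → ℝ, ∀ q ∈ Ideal.span F, aeval x q = 0) ∧
    (∀ x : Fin n → ℝ, (∀ q ∈ Ideal.span F, aeval x q = 0) → aeval x f = Λ p) ∧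
    ∀ q : Poly n, (∀ x : Fin n → ℝ, (∀ g ∈ Ideal.span F, aeval x g = 0) → aeval x q = 0) →
      q ∈ Ideal.span F := by
  have := finiteDimensional_quotient hbb
  obtain ⟨L, hpos, hdef, hL⟩ := exists_posDef_form hbb hc hΛ.1 hker
  obtain ⟨h1, hΛ1⟩ := hΛ.1.2.1
  have hL1 : L 1 = 1 := (congrArg L (map_one (Ideal.Quotient.mk _))).symm.trans ((hL ⟨1, h1⟩).trans hΛ1)
  have hrad : ∀ q : Poly n,
      (∀ x : Fin n → ℝ, (∀ g ∈ Ideal.span F, aeval x g = 0) → aeval x q = 0) →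
      q ∈ Ideal.span F := by
    intro q hq
    refine Ideal.Quotient.eq_zero_iff_mem.1
      (eq_zero_of_forall_algHom_of_posDef hpos hdef fun χ => ?_)
    obtain ⟨x, hx, hx0⟩ := exists_point_of_algHom χ
    rw [hx]
    exact hq x hx0
  refine ⟨?_, ?_, hrad⟩
  · by_contra! hne
    have : (1 : Poly n) ∈ Ideal.span F := hrad 1 fun x hx => by
      obtain ⟨q, hq, hq0⟩ := hne x
      exact absurd (hx q hq) hq0
    rw [← Ideal.Quotient.eq_zero_iff_mem, map_one] at this
    rw [this, map_zero] at hL1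
    exact zero_ne_one hL1
  · -- `f - Λ(p)` is nonnegative at the real zeros of `F`, and the form `L` vanishes on it
    have hfp : Ideal.Quotient.mk (Ideal.span F) f = Ideal.Quotient.mk _ (p : Poly n) :=
      Ideal.Quotient.mk_eq_mk_iff_sub_mem _ _ |>.2 (spanD_le_ideal F d hp)
    have hzero : Ideal.Quotient.mk (Ideal.span F) f - algebraMap ℝ _ (Λ p) = 0 := by
      refine eq_zero_of_posDef hpos hdef (fun χ => ?_) ?_
      · obtain ⟨x, hx, hx0⟩ := exists_point_of_algHom χ
        rw [map_sub, hx, AlgHom.commutes, sub_nonneg]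
        have := muValue_le_aeval B hbb.connected.1 hp hx0
        rw [← hΛ.2] at this
        exact EReal.coe_le_coe_iff.1 this
      · rw [map_sub, hfp, hL, Algebra.algebraMap_eq_smul_one, map_smul, hL1, smul_eq_mul, mul_one,
          sub_self]
    intro x hx
    have hmem : f - C (Λ p) ∈ Ideal.span F := by
      rw [← Ideal.Quotient.eq_zero_iff_mem, map_sub]
      exact hzero
    have := hx _ hmem
    rwa [map_sub, aeval_C, sub_eq_zero] at this

/-- The kernel of an optimal generic form vanishes at all minimizers, once the relaxed minimum is
known to be the minimum. -/
theorem hankelKer_subset_minimizerIdeal {f : Poly n} {F : Set (Poly n)} {B M : Set (Mon n)}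
    (hM : M.Finite) (h0 : 0 ∈ M) (hF : F ⊆ minimizerIdeal f) {d : ℕ}
    {p : ↥(monSpan M * monSpan M)} (hp : Represents F d f p)
    {Λ : Module.Dual ℝ ↥(monSpan M * monSpan M)}
    (hΛ : IsOptimalLinearForm (relations F B M) (monSpan M) p Λ)
    (hmin : ∀ x ∈ minimizers f,
      ((aeval x f : ℝ) : EReal) = muValue (relations F B M) (monSpan M) p)
    {E : Submodule ℝ (Poly n)} (hE : E ≤ monSpan M) :
    (hankelKer hE Λ : Set (Poly n)) ⊆ minimizerIdeal f := by
  have := finiteDimensional_monSpan (n := n) hM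
  intro q hq
  obtain ⟨hqE, hq0⟩ := (mem_hankelKer_iff hE hΛ.1.1 q).1 hq
  rw [SetLike.mem_coe, mem_minimizerIdeal]
  intro x hx
  have hxF : ∀ g ∈ Ideal.span F, aeval x g = 0 := fun g hg =>
    mem_minimizerIdeal.1 (Ideal.span_le.2 hF hg) x hx
  have hfeas := evalForm_mem_feasible B h0 hxF
  have hxmin : evalForm (monSpan M) x ∈ minForms (relations F B M) (monSpan M) p :=
    ⟨hfeas, by rw [evalForm_apply, aeval_eq_of_represents hp hxF, hmin x hx]⟩
  have hmem := ker_hankel_le_of_isOptimalLinearForm hΛ hxmin ((mem_ker_hankel_iff hΛ.1.1 _).2 hq0)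
  rw [mem_ker_hankel_iff hfeas, hankel_evalForm] at hmem
  exact mul_self_eq_zero.1 hmem

end MinimizerIdeal

end

theorem mainTheorem7 (n : ℕ) (f : MinimizerIdeal.Poly n)
    (hproper : MinimizerIdeal.minimizerIdeal f ≠ ⊤)
    (hzero : MinimizerIdeal.IsZeroDimensional (MinimizerIdeal.minimizerIdeal f))
    (F' : Set (MinimizerIdeal.Poly n)) (B' : Set (MinimizerIdeal.Mon n)) (v : EReal)
    (hterm : MinimizerIdeal.TerminatesWith f F' B' v) :
    MinimizerIdeal.IsBorderBasisOf (MinimizerIdeal.minimizerIdeal f) F' B' := by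
  open MinimizerIdeal MvPolynomial in
  obtain ⟨s, hreach, -, F, B, p, Λ, p', Λ', hS, hval, hker⟩ := hterm
  have hg := hS.basisComputed.noGap
  have hbasis := hS.basisComputed.basis
  have hB0 : (0 : Mon n) ∈ B' := hbasis.1.connected.1
  have hdeg : ∀ b ∈ B', b.degree < s.t - 1 := fun b hb =>
    not_le.1 fun h => hS.degree_lt ⟨b, hb, h⟩
  obtain ⟨hbb, hc⟩ := hbasis.1.isBorderBasis fun b hb => by have := hdeg b hb; omega
  have htrunc : truncMon B' (s.t - 1) = B' :=
    Set.Subset.antisymm (truncMon_subset B' _) fun b hb => ⟨hb, (hdeg b hb).le⟩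
  have hker' : ∀ q, hankel (monSpan B') Λ' q q = 0 → q = 0 := by
    intro q hq
    have : (q : Poly n) ∈ hankelKer (monSpan_mono (truncMon_subset B' (s.t - 1))) Λ' :=
      (mem_hankelKer_iff _ hS.optimal.1.1 _).2 ⟨by rw [htrunc]; exact q.2, hq⟩
    rw [hker, Submodule.mem_bot] at this
    exact Subtype.ext this
  obtain ⟨⟨y, hy⟩, hf, hrad⟩ := realRadical_of_optimal hbb hc hS.objective hS.optimal.1 hker'
  have hFI : F ⊆ minimizerIdeal f :=
    hg.update.subset_ideal (state_subset_minimizerIdeal hreach)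
  obtain ⟨-, -, hBconn, hBcompl, -, -⟩ := hg.update
  have h0 : (0 : Mon n) ∈ truncMon B s.t := ⟨hBconn.1, by simp⟩
  have hv : muValue (relations F B (truncMon B s.t)) (spaceAt B s.t) p = ((Λ' p' : ℝ) : EReal) := by
    rw [← hS.basisComputed.value, ← hval, hS.optimal.1.2]
  have hle : ∀ x ∈ minimizers f, Λ' p' ≤ aeval x f := by
    intro x hx
    have := muValue_le_aeval B h0 hg.objective (x := x) fun q hq =>
      mem_minimizerIdeal.1 (Ideal.span_le.2 hFI hq) x hx
    rw [hv] at this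
    exact EReal.coe_le_coe_iff.1 this
  -- the relaxed minimum is the value of `f` at `y`, hence not less than the minimum of `f`
  have hmin : ∀ x ∈ minimizers f, aeval x f = Λ' p' := by
    intro x hx
    refine le_antisymm ?_ (hle x hx)
    rw [← hf y hy]
    exact hx y
  obtain ⟨x₀, hx₀⟩ : (minimizers f).Nonempty := by
    rw [Set.nonempty_iff_ne_empty]
    intro h
    exact hproper (by rw [minimizerIdeal, h, vanishingIdeal_empty])
  refine ⟨hbb, le_antisymm (Ideal.span_le.2 ?_) fun q hq => hrad q fun x hx => ?_⟩
  · refine hbasis.2.1.trans (Ideal.span_le.2 (Set.union_subset hFI ?_))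
    exact hankelKer_subset_minimizerIdeal
      (hBcompl.rewriting.finite.subset (truncMon_subset B s.t)) h0 hFI hg.objective
      hS.basisComputed.optimal (fun x hx => by rw [hmin x hx, hv]) _
  · refine mem_minimizerIdeal.1 hq x fun z => ?_
    have h1 : eval x f = eval x₀ f := (hf x hx).trans (hmin x₀ hx₀).symm
    rw [h1]
    exact hx₀ z
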